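/- For $p=(a,b,c,d,e,f,\alpha,\beta,\gamma,\delta)\in\mathbf C^{10}$ consider the fourth-order differential operator \[L_p=\theta^4+x\,(a\theta^4+b\theta^3+c\theta^2+d\theta+e)+f x^2(\theta+\alpha)(\theta+\beta)(\theta+\gamma)(\theta+\delta),\qquad \theta=x\tfrac{d}{dx}.\] After division by its leading coefficient $x^4(1+ax+fx^2)$ the operator reads $y^{(iv)}+a_3y'''+a_2y''+a_1y'+a_0y$ with rational functions $a_i\in\mathbf C(x)$. Put \[\mathcal Q=\tfrac12a_2a_3-a_1-\tfrac18a_3^3+a_2'-\tfrac34a_3a_3'-\tfrac12a_3'' ,\] and let $X\subset\mathbf C^{10}$ be the set of all $p$ for which $\mathcal Q=0$ identically in $x$ (the Calabi–Yau condition). Let $\sigma=\tfrac12(\alpha+\beta+\gamma+\delta)$, twice the average exponent at infinity. The symmetric group $S_4$ acts on $\mathbf C^{10}$ by permuting the exponents $\alpha,\beta,\gamma,\delta$; this does not change the operator. **Theorem.** $X$ is an algebraic set. Up to permutation of the exponents, $X$ is the union of ten irreducible components: $X$ is the union of its irreducible components, and these form exactly ten $S_4$-orbits. Three of the ten orbits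 consist of components contained in $\{f=0\}$; the other seven consist of components on which $f$ is not identically zero. These seven are, up to permutation of the exponents, * one transverse component, on which $\sigma$ is not constant; it has dimension $5$; * six components on each of which $\sigma$ is constant; the pairs $(\sigma,\dim)$ are $(0,4)$, $(1,5)$, $(2,6)$, $(3,5)$, $(2,4)$, $(4,4)$. The $6$-dimensional component with $\sigma=2$ (the main component) is the family of all operators \[\theta^4+x\,(a\theta^4+2a\theta^3+(a+d)\theta^2+d\theta+e)+fx^2(\theta+\alpha)(\theta+\beta)(\theta+2-\alpha)(\theta+2-\beta),\qquad a,d,e,f,\alpha,\beta\in\mathbf C .\] -/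

import Mathlib

open MvPolynomial (zeroLocus vanishingIdeal)

noncomputable section

namespace CYDegreeTwo

/-- The parameter space `ℂ¹⁰`: a point `p` consists of the six coefficients
`(a, b, c, d, e, f) = (p (inl 0), …, p (inl 5))` and the four exponents
`(α, β, γ, δ) = (p (inr 0), …, p (inr 3))`. -/
abbrev Param : Type := Fin 6 ⊕ Fin 4 → ℂ

/-! ### The operator and the Calabi–Yau condition -/

section Operator

open Polynomial

/-- `P₀(θ) = θ⁴`. -/
def P₀ : ℂ[X] := X ^ 4

/-- `P₁(θ) = aθ⁴ + bθ³ + cθ² + dθ + e`. -/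
def P₁ (p : Param) : ℂ[X] :=
  C (p (.inl 0)) * X ^ 4 + C (p (.inl 1)) * X ^ 3 + C (p (.inl 2)) * X ^ 2
    + C (p (.inl 3)) * X + C (p (.inl 4))

/-- `P₂(θ) = f(θ + α)(θ + β)(θ + γ)(θ + δ)`. -/
def P₂ (p : Param) : ℂ[X] :=
  C (p (.inl 5)) * ∏ i : Fin 4, (X + C (p (.inr i)))

end Operator

/-- The coefficient of `θᵏ` in the operator `P₀(θ) + x P₁(θ) + x² P₂(θ)`. -/
def thetaCoeff (p : Param) (k : ℕ) (x : ℂ) : ℂ :=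
  P₀.coeff k + x * (P₁ p).coeff k + x ^ 2 * (P₂ p).coeff k

/-- The coefficient of `(d/dx)ʲ` in the same operator. Since `θ = x d/dx`, one has
`θᵏ = ∑ⱼ S(k, j) xʲ (d/dx)ʲ` with `S(k, j)` the Stirling numbers of the second kind. -/
def derivCoeff (p : Param) (j : ℕ) (x : ℂ) : ℂ :=
  x ^ j * ∑ k ∈ Finset.range 5, (Nat.stirlingSecond k j : ℂ) * thetaCoeff p k x

/-- The coefficient `aⱼ(x)` of the monic form `y⁗ + a₃ y‴ + a₂ y″ + a₁ y′ + a₀ y`; the leading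
coefficient divided out is `x⁴ (1 + a x + f x²)`. -/
def monicCoeff (p : Param) (j : ℕ) (x : ℂ) : ℂ :=
  derivCoeff p j x / derivCoeff p 4 x

/-- `𝒬 = ½ a₂ a₃ - a₁ - ⅛ a₃³ + a₂′ - ¾ a₃ a₃′ - ½ a₃″`. -/
def calQ (p : Param) (x : ℂ) : ℂ :=
  1 / 2 * monicCoeff p 2 x * monicCoeff p 3 x - monicCoeff p 1 x
    - 1 / 8 * monicCoeff p 3 x ^ 3 + deriv (monicCoeff p 2) x
    - 3 / 4 * monicCoeff p 3 x * deriv (monicCoeff p 3) x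
    - 1 / 2 * deriv (deriv (monicCoeff p 3)) x

/-- The set `X ⊂ ℂ¹⁰` of parameters for which the rational function `𝒬` vanishes identically,
that is, at every point where its denominator does not vanish. -/
def cySet : Set Param :=
  {p | ∀ x : ℂ, derivCoeff p 4 x ≠ 0 → calQ p x = 0}

/-! ### Algebraic sets, irreducible components, dimension -/

/-- `Z` is an algebraic set, i.e. Zariski closed in `ℂ¹⁰`. -/
def IsAlgebraicSet (Z : Set Param) : Prop :=
  ∃ I : Ideal (MvPolynomial (Fin 6 ⊕ Fin 4) ℂ), Z = zeroLocus ℂ I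

/-- `Z` is an irreducible algebraic set. -/
def IsIrreducibleAlgebraicSet (Z : Set Param) : Prop :=
  IsAlgebraicSet Z ∧ Z.Nonempty ∧
    ∀ Z₁ Z₂ : Set Param, IsAlgebraicSet Z₁ → IsAlgebraicSet Z₂ → Z ⊆ Z₁ ∪ Z₂ →
      Z ⊆ Z₁ ∨ Z ⊆ Z₂

/-- `Z` is an irreducible component of `X`: a maximal irreducible algebraic subset. -/
def IsComponent (X Z : Set Param) : Prop :=
  Maximal (fun W => IsIrreducibleAlgebraicSet W ∧ W ⊆ X) Z

/-- The dimension of an irreducible algebraic set: the transcendence degree over `ℂ` of its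
coordinate ring. -/
def dimension (Z : Set Param) : Cardinal :=
  Algebra.trdeg ℂ (MvPolynomial (Fin 6 ⊕ Fin 4) ℂ ⧸ vanishingIdeal ℂ Z)

/-! ### Exponents -/

/-- Reordering the four exponents; the operator itself does not change. -/
def permuteExponents (τ : Equiv.Perm (Fin 4)) (p : Param) : Param :=
  fun i => p (Sum.map id τ i)

/-- `σ = (α + β + γ + δ) / 2`, twice the average exponent at infinity. -/
def sigma (p : Param) : ℂ :=
  (∑ i : Fin 4, p (.inr i)) / 2

/-- The parameters of the operators
`θ⁴ + x(aθ⁴ + 2aθ³ + (a + d)θ² + dθ + e) + f x²(θ + α)(θ + β)(θ + 2 - α)(θ + 2 - β)`. -/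
def mainFamily : Set Param :=
  {p | ∃ a d e f α β : ℂ,
    p = Sum.elim ![a, 2 * a, a + d, d, e, f] ![α, β, 2 - α, 2 - β]}

end CYDegreeTwo

end

noncomputable section

namespace CYDegreeTwo

/-! ### Algebraic sets -/

/-! Write `D = 1 + ax + fx²`. Clearing denominators turns `8x³D³𝒬` into a polynomial with six
coefficients, so `X` is cut out by six equations in `a, b, c, d, f` and the elementary symmetric
functions `s₁, s₂, s₃` of the exponents (`calQ_eq`, `mem_cySet_iff`); `e` does not occur in them.

If `f = 0`, the equations factor and leave three linear families, with `b = 0`, `2a` or `4a`.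

If `f ≠ 0`, the top coefficient says `s₁³ - 4s₁s₂ + 8s₃ = 0`. This cubic is the product of the three
differences between complementary pair sums, so after a permutation `α + γ = β + δ`. Factor `D = (1
+ ux)(1 + vx)`. At a simple root the third-order pole of `𝒬` forces the residue `r` of the
`θ³`-coefficient to be `0`, `2` or `4`, and the second-order pole fixes the residue of the
`θ²`-coefficient unless `r = 2` (`polarParts_eq_zero`). Since `σ = (r₁ + r₂)/2`, the unordered pairs
of residues give the six components with constant `σ`. If `u = v`, there is no restriction on the
residue, and the transverse component appears besides points of the main one
(`polarParts_eq_zero_of_double`).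

Each family is a closed embedding of an affine space with polynomial left inverse (`Chart`), hence
closed, irreducible and of the expected dimension. Permutation-invariant conditions and a test point
on each family show that no family lies in a reordering of another, so the finite union
`cySet_eq_iUnion` is the decomposition into components. -/

theorem isAlgebraicSet_empty : IsAlgebraicSet ∅ :=
  ⟨⊤, by simp⟩

theorem IsAlgebraicSet.union {Z₁ Z₂ : Set Param} (h₁ : IsAlgebraicSet Z₁)
    (h₂ : IsAlgebraicSet Z₂) : IsAlgebraicSet (Z₁ ∪ Z₂) := by
  obtain ⟨I, rfl⟩ := h₁
  obtain ⟨J, rfl⟩ := h₂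
  refine ⟨I * J, Set.Subset.antisymm ?_ ?_⟩
  · exact Set.union_subset (MvPolynomial.zeroLocus_anti_mono Ideal.mul_le_left)
      (MvPolynomial.zeroLocus_anti_mono Ideal.mul_le_right)
  · intro x hx
    by_contra hc
    simp only [Set.mem_union, MvPolynomial.mem_zeroLocus_iff, not_or, not_forall] at hc
    obtain ⟨⟨g, hg, hgx⟩, h, hh, hhx⟩ := hc
    have := hx (g * h) (Ideal.mul_mem_mul hg hh)
    rw [map_mul] at this
    exact (mul_ne_zero hgx hhx) this

theorem isAlgebraicSet_biUnion {ι : Type*} (s : Finset ι) (Z : ι → Set Param)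
    (hZ : ∀ i, IsAlgebraicSet (Z i)) : IsAlgebraicSet (⋃ i ∈ s, Z i) := by
  classical
  induction s using Finset.induction_on with
  | empty => simpa using isAlgebraicSet_empty
  | insert i s _ ih =>
    rw [Finset.set_biUnion_insert]
    exact (hZ i).union ih

theorem isAlgebraicSet_iUnion {ι : Type*} [Fintype ι] (Z : ι → Set Param)
    (hZ : ∀ i, IsAlgebraicSet (Z i)) : IsAlgebraicSet (⋃ i, Z i) := by
  simpa using isAlgebraicSet_biUnion Finset.univ Z hZ

theorem IsIrreducibleAlgebraicSet.subset_of_subset_biUnion {W : Set Param}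
    (hW : IsIrreducibleAlgebraicSet W) {ι : Type*} (s : Finset ι) (Z : ι → Set Param)
    (hZ : ∀ i, IsAlgebraicSet (Z i)) (h : W ⊆ ⋃ i ∈ s, Z i) : ∃ i, W ⊆ Z i := by
  classical
  induction s using Finset.induction_on with
  | empty =>
    obtain ⟨x, hx⟩ := hW.2.1
    simpa using h hx
  | insert i s _ ih =>
    rw [Finset.set_biUnion_insert] at h
    rcases hW.2.2 _ _ (hZ i) (isAlgebraicSet_biUnion s Z hZ) h with h | h
    · exact ⟨i, h⟩
    · exact ih h

theorem IsIrreducibleAlgebraicSet.subset_of_subset_iUnion {W : Set Param}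
    (hW : IsIrreducibleAlgebraicSet W) {ι : Type*} [Fintype ι] (Z : ι → Set Param)
    (hZ : ∀ i, IsAlgebraicSet (Z i)) (h : W ⊆ ⋃ i, Z i) : ∃ i, W ⊆ Z i :=
  hW.subset_of_subset_biUnion Finset.univ Z hZ (by simpa using h)

/-- If `X` is the union of finitely many irreducible algebraic sets, among which inclusions are
equalities, then these sets are the irreducible components of `X`. -/
theorem isComponent_iff_of_eq_iUnion {X : Set Param} {ι : Type*} [Fintype ι]
    {Z : ι → Set Param} (hX : X = ⋃ i, Z i) (hZ : ∀ i, IsIrreducibleAlgebraicSet (Z i))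
    (hle : ∀ i j, Z i ⊆ Z j → Z i = Z j) {W : Set Param} :
    IsComponent X W ↔ ∃ i, W = Z i := by
  have hsub : ∀ i, Z i ⊆ X := fun i => hX ▸ Set.subset_iUnion Z i
  constructor
  · intro hW
    obtain ⟨i, hi⟩ := hW.1.1.subset_of_subset_iUnion Z (fun i => (hZ i).1) (hX ▸ hW.1.2)
    exact ⟨i, Set.Subset.antisymm hi (hW.2 ⟨hZ i, hsub i⟩ hi)⟩
  · rintro ⟨i, rfl⟩
    refine ⟨⟨hZ i, hsub i⟩, fun V hV hle' => ?_⟩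
    obtain ⟨j, hj⟩ := hV.1.subset_of_subset_iUnion Z (fun i => (hZ i).1) (hX ▸ hV.2)
    have := hle i j (hle'.trans hj)
    rw [this]
    exact hj

/-! ### Sets with a polynomial parametrization that has a polynomial left inverse -/

/-- A closed embedding of affine `n`-space into `ℂ¹⁰`: a polynomial map together with a polynomial
left inverse. -/
structure Chart (n : ℕ) where
  /-- The coordinates of the embedding. -/
  coord : Fin 6 ⊕ Fin 4 → MvPolynomial (Fin n) ℂ
  /-- The coordinates of the left inverse. -/
  inv : Fin n → MvPolynomial (Fin 6 ⊕ Fin 4) ℂ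
  left_inv : ∀ j, MvPolynomial.aeval coord (inv j) = MvPolynomial.X j

namespace Chart

open MvPolynomial

variable {n : ℕ}

/-- The point of the image with the given parameters. -/
def point (c : Chart n) (t : Fin n → ℂ) : Param := fun i => aeval t (c.coord i)

/-- The image of the embedding. -/
def image (c : Chart n) : Set Param := Set.range c.point

theorem aeval_point (c : Chart n) (t : Fin n → ℂ) (g : MvPolynomial (Fin 6 ⊕ Fin 4) ℂ) :
    aeval (c.point t) g = aeval t (aeval c.coord g) := by
  have : (aeval (c.point t) : _ →ₐ[ℂ] ℂ) = (aeval t).comp (aeval c.coord) := by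
    ext i
    simp [point]
  exact DFunLike.congr_fun this g

/-- The image is the fixed-point set of the retraction `coord ∘ inv`. This gives explicit polynomial
equations for it. -/
theorem mem_image_iff (c : Chart n) {p : Param} :
    p ∈ c.image ↔ ∀ i, p i = aeval (fun j => aeval p (c.inv j)) (c.coord i) := by
  constructor
  · rintro ⟨t, rfl⟩ i
    have : (fun j => aeval (c.point t) (c.inv j)) = t := by
      ext j
      rw [aeval_point, c.left_inv, aeval_X]
    rw [this, point]
  · intro h
    exact ⟨_, (funext h).symm⟩

theorem isAlgebraicSet_image (c : Chart n) : IsAlgebraicSet c.image := by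
  refine ⟨Ideal.span (Set.range fun i => X i - aeval c.inv (c.coord i)), ?_⟩
  ext p
  have key : ∀ i, aeval p (aeval c.inv (c.coord i)) =
      aeval (fun j => aeval p (c.inv j)) (c.coord i) := fun i => by
    have : (aeval p : _ →ₐ[ℂ] ℂ).comp (aeval c.inv) = aeval (fun j => aeval p (c.inv j)) := by
      ext j
      simp
    exact DFunLike.congr_fun this _
  rw [mem_image_iff, zeroLocus_span]
  simp only [Set.forall_mem_range, Set.mem_ofPred_eq, map_sub, aeval_X, key, sub_eq_zero]

theorem isIrreducibleAlgebraicSet_image (c : Chart n) : IsIrreducibleAlgebraicSet c.image := by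
  refine ⟨c.isAlgebraicSet_image, Set.range_nonempty _, ?_⟩
  rintro _ _ ⟨I, rfl⟩ ⟨J, rfl⟩ h
  by_contra hc
  simp only [not_or, Set.not_subset, mem_zeroLocus_iff, not_forall] at hc
  obtain ⟨⟨_, ⟨t, rfl⟩, g, hg, hgt⟩, _, ⟨s, rfl⟩, k, hk, hks⟩ := hc
  rw [aeval_point] at hgt hks
  -- Pulled back to affine space, the product vanishes at every point, hence is the zero polynomial;
  -- the polynomial ring is a domain, so one factor is zero.
  have hprod : aeval c.coord g * aeval c.coord k = 0 := by
    refine MvPolynomial.funext fun r => ?_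
    rw [map_mul, map_zero]
    rcases h ⟨r, rfl⟩ with h | h
    · have := h g hg
      rw [aeval_point, aeval_eq_eval] at this
      rw [this, zero_mul]
    · have := h k hk
      rw [aeval_point, aeval_eq_eval] at this
      rw [this, mul_zero]
  rcases mul_eq_zero.mp hprod with h0 | h0
  · exact hgt (by rw [h0, map_zero])
  · exact hks (by rw [h0, map_zero])

theorem vanishingIdeal_image (c : Chart n) :
    vanishingIdeal ℂ c.image = RingHom.ker (aeval c.coord : _ →ₐ[ℂ] MvPolynomial (Fin n) ℂ) := by
  ext g
  rw [mem_vanishingIdeal_iff, RingHom.mem_ker]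
  constructor
  · intro h
    refine MvPolynomial.funext fun r => ?_
    have := h _ ⟨r, rfl⟩
    rwa [aeval_point, aeval_eq_eval] at this
  · rintro h _ ⟨t, rfl⟩
    rw [aeval_point, h, map_zero]

theorem aeval_coord_surjective (c : Chart n) :
    Function.Surjective (aeval c.coord : _ →ₐ[ℂ] MvPolynomial (Fin n) ℂ) := by
  intro g
  refine ⟨aeval c.inv g, ?_⟩
  have : (aeval c.coord : _ →ₐ[ℂ] MvPolynomial (Fin n) ℂ).comp (aeval c.inv) =
      AlgHom.id ℂ _ := by
    ext1 j
    simpa using c.left_inv j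
  exact DFunLike.congr_fun this g

/-- Pullback along the embedding is surjective because of the left inverse, and its kernel is the
vanishing ideal. The coordinate ring is therefore a polynomial ring in `n` variables. -/
theorem dimension_image (c : Chart n) : dimension c.image = n := by
  rw [dimension, vanishingIdeal_image,
    (Ideal.quotientKerAlgEquivOfSurjective c.aeval_coord_surjective).trdeg_eq,
    MvPolynomial.trdeg_of_isDomain]
  simp

/-- The embedding followed by a permutation of the exponents. -/
def permute (c : Chart n) (τ : Equiv.Perm (Fin 4)) : Chart n where
  coord := c.coord ∘ Sum.map id τ
  inv j := rename (Sum.map id τ.symm) (c.inv j)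
  left_inv j := by
    rw [aeval_rename, ← c.left_inv j]
    congr 2
    ext1 i
    rcases i with i | i <;> simp

theorem image_permute (c : Chart n) (τ : Equiv.Perm (Fin 4)) :
    (c.permute τ).image = permuteExponents τ '' c.image := by
  rw [image, image, ← Set.range_comp]
  rfl

end Chart

/-! ### Permutations of the exponents -/

theorem permuteExponents_permuteExponents (τ ρ : Equiv.Perm (Fin 4)) (p : Param) :
    permuteExponents τ (permuteExponents ρ p) = permuteExponents (ρ * τ) p := by
  ext i
  rcases i with i | i <;> rfl

theorem permuteExponents_one (p : Param) : permuteExponents 1 p = p := by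
  ext i
  rcases i with i | i <;> rfl

theorem mem_image_permuteExponents {τ : Equiv.Perm (Fin 4)} {Z : Set Param} {p : Param} :
    p ∈ permuteExponents τ '' Z ↔ permuteExponents τ⁻¹ p ∈ Z := by
  constructor
  · rintro ⟨q, hq, rfl⟩
    rwa [permuteExponents_permuteExponents, mul_inv_cancel, permuteExponents_one]
  · intro h
    exact ⟨_, h, by
      rw [permuteExponents_permuteExponents, inv_mul_cancel, permuteExponents_one]⟩

theorem sigma_permuteExponents (τ : Equiv.Perm (Fin 4)) (p : Param) :
    sigma (permuteExponents τ p) = sigma p := by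
  have : ∑ i, p (.inr (τ i)) = ∑ i, p (.inr i) := Equiv.sum_comp τ fun i => p (.inr i)
  simp [sigma, permuteExponents, this]

/-- An inclusion between two reorderings of the same set is an equality. -/
theorem permuteExponents_image_eq_of_subset {Z : Set Param} {τ ρ : Equiv.Perm (Fin 4)}
    (h : permuteExponents τ '' Z ⊆ permuteExponents ρ '' Z) :
    permuteExponents τ '' Z = permuteExponents ρ '' Z := by
  -- The inclusion says that one group element maps `Z` into itself. It has finite order, so its
  -- inverse is a power of it and also maps `Z` into itself.
  have step : ∀ p ∈ Z, permuteExponents (τ * ρ⁻¹) p ∈ Z := fun p hp => by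
    have := mem_image_permuteExponents.mp (h ⟨p, hp, rfl⟩)
    rwa [permuteExponents_permuteExponents] at this
  have pow : ∀ (n : ℕ), ∀ p ∈ Z, permuteExponents ((τ * ρ⁻¹) ^ n) p ∈ Z := fun n => by
    induction n with
    | zero => intro p hp; rwa [pow_zero, permuteExponents_one]
    | succ n ih =>
      intro p hp
      rw [pow_succ, ← permuteExponents_permuteExponents]
      exact step _ (ih p hp)
  refine h.antisymm ?_
  rintro _ ⟨p, hp, rfl⟩
  rw [mem_image_permuteExponents, permuteExponents_permuteExponents]
  have := pow (orderOf (τ * ρ⁻¹) - 1) p hp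
  have hinv : (τ * ρ⁻¹) ^ (orderOf (τ * ρ⁻¹) - 1) = ρ * τ⁻¹ := by
    have h1 := pow_orderOf_eq_one (τ * ρ⁻¹)
    have hpos := orderOf_pos (τ * ρ⁻¹)
    rw [← Nat.sub_add_cancel hpos, pow_succ, mul_eq_one_iff_eq_inv] at h1
    simpa using h1
  rwa [hinv] at this

/-! ### The Calabi–Yau condition as a system of polynomial equations -/

/-- The coefficients of `x, …, x⁶` in the numerator of `8𝒬`, in terms of the coefficients of the
operator and the elementary symmetric functions `s₁, s₂, s₃` of the exponents. -/
def numeratorCoeff (a b c d f s₁ s₂ s₃ : ℂ) : Fin 6 → ℂ :=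
  ![-8*d + 8*c - 4*b,
    -8*f*s₃ + 16*f*s₂ - 16*f*s₁ + 4*b*c - 6*b^2 - 16*a*d + 8*a*c + 4*a*b,
    -16*d*f + 4*c*f*s₁ + 24*b*f + 4*b*f*s₂ - 18*b*f*s₁ - b^3 - 16*a*f*s₃ + 24*a*f*s₂
      - 12*a*f*s₁ + 4*a*b*c - 8*a^2*d,
    -16*f^2*s₃ + 16*f^2*s₂ + 16*f^2*s₁ + 4*f^2*s₁*s₂ - 12*f^2*s₁^2 + 4*b*c*f + 6*b^2*f
      - 3*b^2*f*s₁ - 16*a*d*f - 8*a*c*f + 4*a*c*f*s₁ + 4*a*b*f + 4*a*b*f*s₂ - 6*a*b*f*s₁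
      - 8*a^2*f*s₃ + 8*a^2*f*s₂ - 4*a^2*f*s₁,
    -8*d*f^2 - 8*c*f^2 + 4*c*f^2*s₁ - 4*b*f^2 + 4*b*f^2*s₂ + 6*b*f^2*s₁ - 3*b*f^2*s₁^2
      - 16*a*f^2*s₃ + 8*a*f^2*s₂ + 4*a*f^2*s₁ + 4*a*f^2*s₁*s₂ - 6*a*f^2*s₁^2,
    -8*f^3*s₃ + 4*f^3*s₁*s₂ - f^3*s₁^3]

/-- The sum of the exponents. -/
def esymmOne (p : Param) : ℂ := p (.inr 0) + p (.inr 1) + p (.inr 2) + p (.inr 3)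

/-- The second elementary symmetric function of the exponents. -/
def esymmTwo (p : Param) : ℂ :=
  p (.inr 0) * p (.inr 1) + p (.inr 0) * p (.inr 2) + p (.inr 0) * p (.inr 3)
    + p (.inr 1) * p (.inr 2) + p (.inr 1) * p (.inr 3) + p (.inr 2) * p (.inr 3)

/-- The third elementary symmetric function of the exponents. -/
def esymmThree (p : Param) : ℂ :=
  p (.inr 0) * p (.inr 1) * p (.inr 2) + p (.inr 0) * p (.inr 1) * p (.inr 3)
    + p (.inr 0) * p (.inr 2) * p (.inr 3) + p (.inr 1) * p (.inr 2) * p (.inr 3)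

/-- The numerator coefficients at a point of the parameter space. -/
def cyEquation (p : Param) : Fin 6 → ℂ :=
  numeratorCoeff (p (.inl 0)) (p (.inl 1)) (p (.inl 2)) (p (.inl 3)) (p (.inl 5))
    (esymmOne p) (esymmTwo p) (esymmThree p)

section Coefficients

open Polynomial

theorem P₂_eq (p : Param) :
    P₂ p = C (p (.inl 5)) * X ^ 4 + C (p (.inl 5) * esymmOne p) * X ^ 3
      + C (p (.inl 5) * esymmTwo p) * X ^ 2 + C (p (.inl 5) * esymmThree p) * X
      + C (p (.inl 5) * (p (.inr 0) * p (.inr 1) * p (.inr 2) * p (.inr 3))) := by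
  simp only [P₂, Fin.prod_univ_four, esymmOne, esymmTwo, esymmThree, map_mul, map_add]
  ring

theorem thetaCoeff_four (p : Param) (x : ℂ) :
    thetaCoeff p 4 x = 1 + p (.inl 0) * x + p (.inl 5) * x ^ 2 := by
  simp [thetaCoeff, P₀, P₁, P₂_eq, -map_mul]
  ring

theorem thetaCoeff_three (p : Param) (x : ℂ) :
    thetaCoeff p 3 x = p (.inl 1) * x + p (.inl 5) * esymmOne p * x ^ 2 := by
  simp [thetaCoeff, P₀, P₁, P₂_eq, coeff_X_pow, -map_mul]
  ring

theorem thetaCoeff_two (p : Param) (x : ℂ) :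
    thetaCoeff p 2 x = p (.inl 2) * x + p (.inl 5) * esymmTwo p * x ^ 2 := by
  simp [thetaCoeff, P₀, P₁, P₂_eq, coeff_X_pow, -map_mul]
  ring

theorem thetaCoeff_one (p : Param) (x : ℂ) :
    thetaCoeff p 1 x = p (.inl 3) * x + p (.inl 5) * esymmThree p * x ^ 2 := by
  simp [thetaCoeff, P₀, P₁, P₂_eq, coeff_C, coeff_X_pow, -map_mul]
  ring

end Coefficients

/-! ### The monic coefficients and their derivatives as fractions. -/

theorem derivCoeff_four (p : Param) (x : ℂ) :
    derivCoeff p 4 x = x ^ 4 * thetaCoeff p 4 x := by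
  simp [derivCoeff, Finset.sum_range_succ, Nat.stirlingSecond]

theorem derivCoeff_three (p : Param) (x : ℂ) :
    derivCoeff p 3 x = x ^ 3 * (thetaCoeff p 3 x + 6 * thetaCoeff p 4 x) := by
  simp [derivCoeff, Finset.sum_range_succ, Nat.stirlingSecond]

theorem derivCoeff_two (p : Param) (x : ℂ) :
    derivCoeff p 2 x =
      x ^ 2 * (thetaCoeff p 2 x + 3 * thetaCoeff p 3 x + 7 * thetaCoeff p 4 x) := by
  simp [derivCoeff, Finset.sum_range_succ, Nat.stirlingSecond]

theorem derivCoeff_one (p : Param) (x : ℂ) :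
    derivCoeff p 1 x =
      x * (thetaCoeff p 1 x + thetaCoeff p 2 x + thetaCoeff p 3 x + thetaCoeff p 4 x) := by
  simp [derivCoeff, Finset.sum_range_succ, Nat.stirlingSecond]

theorem monicCoeff_three (p : Param) {x : ℂ} (hx : x ≠ 0) :
    monicCoeff p 3 x = (thetaCoeff p 3 x + 6 * thetaCoeff p 4 x) / (x * thetaCoeff p 4 x) := by
  rw [monicCoeff, derivCoeff_three, derivCoeff_four,
    show x ^ 4 * thetaCoeff p 4 x = x ^ 3 * (x * thetaCoeff p 4 x) by ring,
    mul_div_mul_left _ _ (pow_ne_zero 3 hx)]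

theorem monicCoeff_two (p : Param) {x : ℂ} (hx : x ≠ 0) :
    monicCoeff p 2 x = (thetaCoeff p 2 x + 3 * thetaCoeff p 3 x + 7 * thetaCoeff p 4 x) /
      (x ^ 2 * thetaCoeff p 4 x) := by
  rw [monicCoeff, derivCoeff_two, derivCoeff_four,
    show x ^ 4 * thetaCoeff p 4 x = x ^ 2 * (x ^ 2 * thetaCoeff p 4 x) by ring,
    mul_div_mul_left _ _ (pow_ne_zero 2 hx)]

theorem monicCoeff_one (p : Param) {x : ℂ} (hx : x ≠ 0) :
    monicCoeff p 1 x = (thetaCoeff p 1 x + thetaCoeff p 2 x + thetaCoeff p 3 x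
      + thetaCoeff p 4 x) / (x ^ 3 * thetaCoeff p 4 x) := by
  rw [monicCoeff, derivCoeff_one, derivCoeff_four,
    show x ^ 4 * thetaCoeff p 4 x = x * (x ^ 3 * thetaCoeff p 4 x) by ring,
    mul_div_mul_left _ _ hx]

theorem hasDerivAt_quadratic (k l m x : ℂ) :
    HasDerivAt (fun y => k + l * y + m * y ^ 2) (l + 2 * m * x) x := by
  have := (((hasDerivAt_id x).const_mul l).const_add k).add (((hasDerivAt_id x).pow 2).const_mul m)
  convert! this using 1
  simp
  ring

theorem hasDerivAt_thetaCoeff_four (p : Param) (x : ℂ) :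
    HasDerivAt (thetaCoeff p 4) (p (.inl 0) + 2 * p (.inl 5) * x) x := by
  rw [funext (thetaCoeff_four p)]
  exact hasDerivAt_quadratic _ _ _ _

theorem hasDerivAt_thetaCoeff_three (p : Param) (x : ℂ) :
    HasDerivAt (thetaCoeff p 3) (p (.inl 1) + 2 * (p (.inl 5) * esymmOne p) * x) x := by
  rw [funext (thetaCoeff_three p)]
  simpa using hasDerivAt_quadratic 0 _ _ _

theorem hasDerivAt_thetaCoeff_two (p : Param) (x : ℂ) :
    HasDerivAt (thetaCoeff p 2) (p (.inl 2) + 2 * (p (.inl 5) * esymmTwo p) * x) x := by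
  rw [funext (thetaCoeff_two p)]
  simpa using hasDerivAt_quadratic 0 _ _ _

theorem eventually_regular (p : Param) {x : ℂ} (hx : x ≠ 0) (hD : thetaCoeff p 4 x ≠ 0) :
    ∀ᶠ y in nhds x, y ≠ 0 ∧ thetaCoeff p 4 y ≠ 0 :=
  (eventually_ne_nhds hx).and
    ((hasDerivAt_thetaCoeff_four p x).continuousAt.eventually_ne hD)

theorem deriv_monicCoeff_two (p : Param) {x : ℂ} (hx : x ≠ 0) (hD : thetaCoeff p 4 x ≠ 0) :
    deriv (monicCoeff p 2) x =
      ((p (.inl 2) + 2 * (p (.inl 5) * esymmTwo p) * x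
        + 3 * (p (.inl 1) + 2 * (p (.inl 5) * esymmOne p) * x)) * x * thetaCoeff p 4 x
      - (thetaCoeff p 2 x + 3 * thetaCoeff p 3 x) *
        (2 * thetaCoeff p 4 x + x * (p (.inl 0) + 2 * p (.inl 5) * x))
      - 14 * thetaCoeff p 4 x ^ 2) / (x ^ 3 * thetaCoeff p 4 x ^ 2) := by
  have hev : monicCoeff p 2 =ᶠ[nhds x] fun y =>
      (thetaCoeff p 2 y + 3 * thetaCoeff p 3 y + 7 * thetaCoeff p 4 y) /
        (y ^ 2 * thetaCoeff p 4 y) :=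
    (eventually_ne_nhds hx).mono fun y hy => monicCoeff_two p hy
  rw [hev.deriv_eq]
  refine HasDerivAt.deriv ?_
  have h4 := hasDerivAt_thetaCoeff_four p x
  convert! (((hasDerivAt_thetaCoeff_two p x).add
    ((hasDerivAt_thetaCoeff_three p x).const_mul 3)).add (h4.const_mul 7)).div
    (((hasDerivAt_id x).pow 2).mul h4) (mul_ne_zero (pow_ne_zero 2 hx) hD) using 1
  simp only [Pi.add_apply, Pi.mul_apply, Pi.pow_apply, id]
  field_simp
  ring

/-- The coefficient splits as `thetaCoeff p 3 x / (x * thetaCoeff p 4 x) + 6 / x`; the last term of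
the numerator comes from `6 / x`. -/
theorem deriv_monicCoeff_three (p : Param) {x : ℂ} (hx : x ≠ 0) (hD : thetaCoeff p 4 x ≠ 0) :
    deriv (monicCoeff p 3) x =
      ((p (.inl 1) + 2 * (p (.inl 5) * esymmOne p) * x) * x * thetaCoeff p 4 x
      - thetaCoeff p 3 x * (thetaCoeff p 4 x + x * (p (.inl 0) + 2 * p (.inl 5) * x))
      - 6 * thetaCoeff p 4 x ^ 2) / (x ^ 2 * thetaCoeff p 4 x ^ 2) := by
  have hev : monicCoeff p 3 =ᶠ[nhds x] fun y =>
      (thetaCoeff p 3 y + 6 * thetaCoeff p 4 y) / (y * thetaCoeff p 4 y) :=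
    (eventually_ne_nhds hx).mono fun y hy => monicCoeff_three p hy
  rw [hev.deriv_eq]
  refine HasDerivAt.deriv ?_
  have h4 := hasDerivAt_thetaCoeff_four p x
  convert! ((hasDerivAt_thetaCoeff_three p x).add (h4.const_mul 6)).div
    ((hasDerivAt_id x).mul h4) (mul_ne_zero hx hD) using 1
  simp only [Pi.add_apply, Pi.mul_apply, id]
  field_simp
  ring

theorem deriv_deriv_monicCoeff_three (p : Param) {x : ℂ} (hx : x ≠ 0)
    (hD : thetaCoeff p 4 x ≠ 0) :
    deriv (deriv (monicCoeff p 3)) x =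
      (2 * (p (.inl 5) * esymmOne p) * x ^ 2 * thetaCoeff p 4 x ^ 2
      - thetaCoeff p 3 x * thetaCoeff p 4 x * x *
        (2 * (p (.inl 0) + 2 * p (.inl 5) * x) + x * (2 * p (.inl 5)))
      - 2 * ((p (.inl 1) + 2 * (p (.inl 5) * esymmOne p) * x) * x * thetaCoeff p 4 x
        - thetaCoeff p 3 x * (thetaCoeff p 4 x + x * (p (.inl 0) + 2 * p (.inl 5) * x)))
        * (thetaCoeff p 4 x + x * (p (.inl 0) + 2 * p (.inl 5) * x))
      + 12 * thetaCoeff p 4 x ^ 3) / (x ^ 3 * thetaCoeff p 4 x ^ 3) := by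
  rw [Filter.EventuallyEq.deriv_eq ((eventually_regular p hx hD).mono
    fun y hy => deriv_monicCoeff_three p hy.1 hy.2)]
  refine HasDerivAt.deriv ?_
  have h4 := hasDerivAt_thetaCoeff_four p x
  have h3 := hasDerivAt_thetaCoeff_three p x
  have hid := hasDerivAt_id x
  have l3 := (hid.const_mul (2 * (p (.inl 5) * esymmOne p))).const_add (p (.inl 1))
  have l4 := (hid.const_mul (2 * p (.inl 5))).const_add (p (.inl 0))
  convert! (((l3.mul hid).mul h4).sub (h3.mul (h4.add (hid.mul l4)))).sub
    ((h4.pow 2).const_mul 6) |>.div ((hid.pow 2).mul (h4.pow 2))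
    (mul_ne_zero (pow_ne_zero 2 hx) (pow_ne_zero 2 hD)) using 1
  simp only [Pi.add_apply, Pi.mul_apply, Pi.sub_apply, Pi.pow_apply, id]
  field_simp
  ring

/-- The rational function `𝒬` as a fraction. -/
theorem calQ_eq (p : Param) {x : ℂ} (hx : x ≠ 0) (hD : thetaCoeff p 4 x ≠ 0) :
    calQ p x = (∑ j : Fin 6, cyEquation p j * x ^ (j + 1 : ℕ)) /
      (8 * x ^ 3 * thetaCoeff p 4 x ^ 3) := by
  rw [calQ, deriv_deriv_monicCoeff_three p hx hD, deriv_monicCoeff_three p hx hD,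
    deriv_monicCoeff_two p hx hD, monicCoeff_one p hx, monicCoeff_two p hx,
    monicCoeff_three p hx]
  have e4 := thetaCoeff_four p x
  -- The leading coefficient stays an atom while denominators are cleared, and is expanded only for
  -- the final polynomial identity.
  generalize thetaCoeff p 4 x = D at hD e4 ⊢
  rw [thetaCoeff_three, thetaCoeff_two, thetaCoeff_one]
  field_simp
  subst e4
  simp only [cyEquation, numeratorCoeff, Fin.sum_univ_succ]
  simp
  ring

theorem mem_cySet_iff (p : Param) : p ∈ cySet ↔ ∀ j, cyEquation p j = 0 := by
  have key : p ∈ cySet ↔ ∀ x : ℂ, x ≠ 0 → thetaCoeff p 4 x ≠ 0 →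
      ∑ j : Fin 6, cyEquation p j * x ^ (j + 1 : ℕ) = 0 := by
    refine forall_congr' fun x => ?_
    rw [derivCoeff_four, mul_ne_zero_iff, and_imp, pow_ne_zero_iff (by norm_num)]
    refine forall_congr' fun hx => forall_congr' fun hD => ?_
    rw [calQ_eq p hx hD, div_eq_zero_iff, or_iff_left (by simp [hx, hD])]
  rw [key]
  constructor
  · intro h
    open Polynomial in
    -- The extra factor kills the excluded points `x = 0` and the roots of the leading coefficient,
    -- so the product vanishes everywhere. That factor is not zero, since its coefficient of `X` is
    -- `1`.
    have hpoly : (∑ j : Fin 6, C (cyEquation p j) * X ^ (j + 1 : ℕ)) *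
        (X * (1 + C (p (.inl 0)) * X + C (p (.inl 5)) * X ^ 2)) = 0 := by
      refine Polynomial.funext fun x => ?_
      by_cases hx : x = 0
      · simp [hx]
      by_cases hD : thetaCoeff p 4 x = 0
      · rw [thetaCoeff_four] at hD
        simp [hD]
      · have := h x hx hD
        simp only [eval_mul, eval_finsetSum, eval_C, eval_pow, eval_X, this, zero_mul, eval_zero]
    rcases mul_eq_zero.mp hpoly with h0 | h0
    · intro j
      have := congrArg (fun g => Polynomial.coeff g (j + 1)) h0
      simpa [Polynomial.finsetSum_coeff, Polynomial.coeff_X_pow, Fin.val_inj] using this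
    · have := congrArg (fun g => Polynomial.coeff g 1) h0
      simp [Polynomial.coeff_X_mul, Polynomial.coeff_one] at this
  · intro h x _ _
    simp [h]

/-! ### The ten components -/

section Charts

open MvPolynomial

/-- The operators `θ⁴ + x(aθ⁴ + e)`. -/
def degenerateZero : Chart 6 where
  coord := Sum.elim ![X 0, 0, 0, 0, X 1, 0] ![X 2, X 3, X 4, X 5]
  inv := ![X (.inl 0), X (.inl 4), X (.inr 0), X (.inr 1), X (.inr 2), X (.inr 3)]
  left_inv j := by fin_cases j <;> simp

/-- The operators `θ⁴ + x(aθ²(θ + 1)² + dθ(θ + 1) + e)`. -/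
def degenerateTwo : Chart 7 where
  coord := Sum.elim ![X 0, 2 * X 0, X 0 + X 1, X 1, X 2, 0] ![X 3, X 4, X 5, X 6]
  inv := ![X (.inl 0), X (.inl 3), X (.inl 4), X (.inr 0), X (.inr 1), X (.inr 2), X (.inr 3)]
  left_inv j := by fin_cases j <;> simp

/-- The operators `θ⁴ + x(a(θ + 1)⁴ + e)`, the constant `a` being absorbed into `e`. -/
def degenerateFour : Chart 6 where
  coord := Sum.elim ![X 0, 4 * X 0, 6 * X 0, 4 * X 0, X 1, 0] ![X 2, X 3, X 4, X 5]
  inv := ![X (.inl 0), X (.inl 4), X (.inr 0), X (.inr 1), X (.inr 2), X (.inr 3)]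
  left_inv j := by fin_cases j <;> simp

/-- The operators with leading coefficient `(1 + tx)²` and exponents `α, β, σ - α, σ - β`, where
`σ` varies. -/
def transverse : Chart 5 where
  coord := Sum.elim
    ![2 * X 0, 2 * X 0 * X 1,
      X 0 * (X 2 * (X 1 - X 2) + X 3 * (X 1 - X 3) + X 1),
      X 0 * (X 2 * (X 1 - X 2) + X 3 * (X 1 - X 3)), X 4, X 0 ^ 2]
    ![X 2, X 3, X 1 - X 2, X 1 - X 3]
  inv := ![C (1 / 2) * X (.inl 0), X (.inr 0) + X (.inr 2), X (.inr 0), X (.inr 1), X (.inl 4)]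
  left_inv j := by
    fin_cases j <;> simp
    rw [← mul_assoc, ← map_ofNat C 2, ← C_mul]
    simp

/-- The operators `(1 + ax + fx²)θ⁴ + ex + εx²`. -/
def sigmaZero : Chart 4 where
  coord := Sum.elim ![X 0, 0, 0, 0, X 1, X 2]
    ![X 3, C Complex.I * X 3, -X 3, -(C Complex.I * X 3)]
  inv := ![X (.inl 0), X (.inl 4), X (.inl 5), X (.inr 0)]
  left_inv j := by fin_cases j <;> simp

/-- The operators with leading coefficient `(1 + ux)(1 + vx)`, of residue `0` at the first factor
and `2` at the second. -/
def sigmaOne : Chart 5 where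
  coord := Sum.elim
    ![X 0 + X 1, 2 * X 1, X 1 * (1 + X 2 * (1 - X 2) + X 3 * (1 - X 3)),
      X 1 * (X 2 * (1 - X 2) + X 3 * (1 - X 3)), X 4, X 0 * X 1]
    ![X 2, X 3, 1 - X 2, 1 - X 3]
  -- Because the residues at the two roots differ, `u` and `v` are linear functions of `a` and `b`.
  -- With equal residues only `a = u + v` and `f = uv` remain visible, and these serve as
  -- coordinates instead.
  inv := ![X (.inl 0) - C (1 / 2) * X (.inl 1), C (1 / 2) * X (.inl 1), X (.inr 0), X (.inr 1),
    X (.inl 4)]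
  left_inv j := by
    have h : C (1 / 2 : ℂ) * (2 * X 1 : MvPolynomial (Fin 5) ℂ) = X 1 := by
      rw [← mul_assoc, ← map_ofNat C 2, ← C_mul]
      simp
    fin_cases j <;> simp_all

/-- The main family. -/
def mainChart : Chart 6 where
  coord := Sum.elim ![X 0, 2 * X 0, X 0 + X 1, X 1, X 2, X 3] ![X 4, X 5, 2 - X 4, 2 - X 5]
  inv := ![X (.inl 0), X (.inl 3), X (.inl 4), X (.inl 5), X (.inr 0), X (.inr 1)]
  left_inv j := by fin_cases j <;> simp

/-- The operators with leading coefficient `(1 + ux)(1 + vx)`, of residue `4` at the first factor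
and `2` at the second. -/
def sigmaThree : Chart 5 where
  coord := Sum.elim
    ![X 0 + X 1, 4 * X 0 + 2 * X 1,
      6 * X 0 + X 1 * (1 + X 2 * (1 - X 2) + X 3 * (1 - X 3)),
      4 * X 0 + X 1 * (X 2 * (1 - X 2) + X 3 * (1 - X 3)), X 4, X 0 * X 1]
    ![1 + X 2, 1 + X 3, 2 - X 2, 2 - X 3]
  inv := ![C (1 / 2) * X (.inl 1) - X (.inl 0), 2 * X (.inl 0) - C (1 / 2) * X (.inl 1),
    X (.inr 0) - 1, X (.inr 1) - 1, X (.inl 4)]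
  left_inv j := by
    have h : C (1 / 2 : ℂ) * (4 * X 0 + 2 * X 1 : MvPolynomial (Fin 5) ℂ) = 2 * X 0 + X 1 := by
      rw [show (4 * X 0 + 2 * X 1 : MvPolynomial (Fin 5) ℂ) = 2 * (2 * X 0 + X 1) by ring,
        ← mul_assoc, ← map_ofNat C 2, ← C_mul]
      simp
    fin_cases j <;> simp_all [map_ofNat] <;> ring

/-- The operators with leading coefficient `(1 + ux)(1 + vx)`, of residue `0` at the first factor
and `4` at the second. -/
def sigmaTwo : Chart 4 where
  coord := Sum.elim ![X 0 + X 1, 4 * X 1, 6 * X 1, 4 * X 1, X 2, X 0 * X 1]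
    ![1 + X 3, 1 + C Complex.I * X 3, 1 - X 3, 1 - C Complex.I * X 3]
  inv := ![X (.inl 0) - C (1 / 4) * X (.inl 1), C (1 / 4) * X (.inl 1), X (.inl 4), X (.inr 0) - 1]
  left_inv j := by
    have h : C (1 / 4 : ℂ) * (4 * X 1 : MvPolynomial (Fin 4) ℂ) = X 1 := by
      rw [← mul_assoc, ← map_ofNat C 4, ← C_mul]
      simp
    fin_cases j <;> simp_all

/-- The operators `θ⁴ + x(a(θ + 1)⁴ + e) + x²(f(θ + 2)⁴ + ε)`, the constant `a` being absorbed
into `e`. -/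
def sigmaFour : Chart 4 where
  coord := Sum.elim ![X 0, 4 * X 0, 6 * X 0, 4 * X 0, X 1, X 2]
    ![2 + X 3, 2 + C Complex.I * X 3, 2 - X 3, 2 - C Complex.I * X 3]
  inv := ![X (.inl 0), X (.inl 4), X (.inl 5), X (.inr 0) - 2]
  left_inv j := by fin_cases j <;> simp [map_ofNat]

/-! ### Membership in the ten families. -/

theorem mem_degenerateZero {p : Param} : p ∈ degenerateZero.image ↔
    p (.inl 1) = 0 ∧ p (.inl 2) = 0 ∧ p (.inl 3) = 0 ∧ p (.inl 5) = 0 := by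
  simp [Chart.mem_image_iff, degenerateZero, Fin.forall_fin_succ]

theorem mem_degenerateTwo {p : Param} : p ∈ degenerateTwo.image ↔
    p (.inl 1) = 2 * p (.inl 0) ∧ p (.inl 2) = p (.inl 0) + p (.inl 3) ∧ p (.inl 5) = 0 := by
  simp [Chart.mem_image_iff, degenerateTwo, Fin.forall_fin_succ]

theorem mem_degenerateFour {p : Param} : p ∈ degenerateFour.image ↔
    p (.inl 1) = 4 * p (.inl 0) ∧ p (.inl 2) = 6 * p (.inl 0) ∧ p (.inl 3) = 4 * p (.inl 0) ∧
      p (.inl 5) = 0 := by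
  simp [Chart.mem_image_iff, degenerateFour, Fin.forall_fin_succ]

/-- The free parameter `e` is left out of the description, since it does not enter `cyEquation`. -/
theorem mem_transverse {p : Param} : p ∈ transverse.image ↔ ∃ t σ α β : ℂ,
    p (.inl 0) = 2 * t ∧ p (.inl 1) = 2 * t * σ ∧
    p (.inl 2) = t * (α * (σ - α) + β * (σ - β) + σ) ∧
    p (.inl 3) = t * (α * (σ - α) + β * (σ - β)) ∧
    p (.inl 5) = t ^ 2 ∧
    p (.inr 0) = α ∧ p (.inr 1) = β ∧ p (.inr 2) = σ - α ∧ p (.inr 3) = σ - β := by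
  constructor
  · rintro ⟨t, rfl⟩
    exact ⟨t 0, t 1, t 2, t 3, by simp [Chart.point, transverse]⟩
  · rintro ⟨t, σ, α, β, h⟩
    refine ⟨![t, σ, α, β, p (.inl 4)], ?_⟩
    ext i
    rcases i with i | i <;> fin_cases i <;> simp [Chart.point, transverse, h]

theorem mem_sigmaZero {p : Param} : p ∈ sigmaZero.image ↔ ∃ α : ℂ,
    p (.inl 1) = 0 ∧ p (.inl 2) = 0 ∧ p (.inl 3) = 0 ∧
    p (.inr 0) = α ∧ p (.inr 1) = Complex.I * α ∧ p (.inr 2) = -α ∧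
    p (.inr 3) = -(Complex.I * α) := by
  constructor
  · rintro ⟨t, rfl⟩
    exact ⟨t 3, by simp [Chart.point, sigmaZero]⟩
  · rintro ⟨α, h⟩
    refine ⟨![p (.inl 0), p (.inl 4), p (.inl 5), α], ?_⟩
    ext i
    rcases i with i | i <;> fin_cases i <;> simp [Chart.point, sigmaZero, h]

theorem mem_sigmaOne {p : Param} : p ∈ sigmaOne.image ↔ ∃ u v α β : ℂ,
    p (.inl 0) = u + v ∧ p (.inl 1) = 2 * v ∧
    p (.inl 2) = v * (1 + α * (1 - α) + β * (1 - β)) ∧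
    p (.inl 3) = v * (α * (1 - α) + β * (1 - β)) ∧
    p (.inl 5) = u * v ∧
    p (.inr 0) = α ∧ p (.inr 1) = β ∧ p (.inr 2) = 1 - α ∧ p (.inr 3) = 1 - β := by
  constructor
  · rintro ⟨t, rfl⟩
    exact ⟨t 0, t 1, t 2, t 3, by simp [Chart.point, sigmaOne]⟩
  · rintro ⟨u, v, α, β, h⟩
    refine ⟨![u, v, α, β, p (.inl 4)], ?_⟩
    ext i
    rcases i with i | i <;> fin_cases i <;> simp [Chart.point, sigmaOne, h]

theorem mem_mainChart {p : Param} : p ∈ mainChart.image ↔ ∃ a d α β : ℂ,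
    p (.inl 0) = a ∧ p (.inl 1) = 2 * a ∧
    p (.inl 2) = a + d ∧ p (.inl 3) = d ∧
    p (.inr 0) = α ∧ p (.inr 1) = β ∧ p (.inr 2) = 2 - α ∧ p (.inr 3) = 2 - β := by
  constructor
  · rintro ⟨t, rfl⟩
    exact ⟨t 0, t 1, t 4, t 5, by simp [Chart.point, mainChart]⟩
  · rintro ⟨a, d, α, β, h⟩
    refine ⟨![a, d, p (.inl 4), p (.inl 5), α, β], ?_⟩
    ext i
    rcases i with i | i <;> fin_cases i <;> simp [Chart.point, mainChart, h]

theorem mem_sigmaThree {p : Param} : p ∈ sigmaThree.image ↔ ∃ u v α β : ℂ,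
    p (.inl 0) = u + v ∧ p (.inl 1) = 4 * u + 2 * v ∧
    p (.inl 2) = 6 * u + v * (1 + α * (1 - α) + β * (1 - β)) ∧
    p (.inl 3) = 4 * u + v * (α * (1 - α) + β * (1 - β)) ∧
    p (.inl 5) = u * v ∧
    p (.inr 0) = 1 + α ∧ p (.inr 1) = 1 + β ∧ p (.inr 2) = 2 - α ∧ p (.inr 3) = 2 - β := by
  constructor
  · rintro ⟨t, rfl⟩
    exact ⟨t 0, t 1, t 2, t 3, by simp [Chart.point, sigmaThree]⟩
  · rintro ⟨u, v, α, β, h⟩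
    refine ⟨![u, v, α, β, p (.inl 4)], ?_⟩
    ext i
    rcases i with i | i <;> fin_cases i <;> simp [Chart.point, sigmaThree, h]

theorem mem_sigmaTwo {p : Param} : p ∈ sigmaTwo.image ↔ ∃ u v α : ℂ,
    p (.inl 0) = u + v ∧ p (.inl 1) = 4 * v ∧
    p (.inl 2) = 6 * v ∧ p (.inl 3) = 4 * v ∧
    p (.inl 5) = u * v ∧
    p (.inr 0) = 1 + α ∧ p (.inr 1) = 1 + Complex.I * α ∧ p (.inr 2) = 1 - α ∧
    p (.inr 3) = 1 - Complex.I * α := by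
  constructor
  · rintro ⟨t, rfl⟩
    exact ⟨t 0, t 1, t 3, by simp [Chart.point, sigmaTwo]⟩
  · rintro ⟨u, v, α, h⟩
    refine ⟨![u, v, p (.inl 4), α], ?_⟩
    ext i
    rcases i with i | i <;> fin_cases i <;> simp [Chart.point, sigmaTwo, h]

theorem mem_sigmaFour {p : Param} : p ∈ sigmaFour.image ↔ ∃ a α : ℂ,
    p (.inl 0) = a ∧ p (.inl 1) = 4 * a ∧
    p (.inl 2) = 6 * a ∧ p (.inl 3) = 4 * a ∧
    p (.inr 0) = 2 + α ∧ p (.inr 1) = 2 + Complex.I * α ∧ p (.inr 2) = 2 - α ∧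
    p (.inr 3) = 2 - Complex.I * α := by
  constructor
  · rintro ⟨t, rfl⟩
    exact ⟨t 0, t 3, by simp [Chart.point, sigmaFour]⟩
  · rintro ⟨a, α, h⟩
    refine ⟨![a, p (.inl 4), p (.inl 5), α], ?_⟩
    ext i
    rcases i with i | i <;> fin_cases i <;> simp [Chart.point, sigmaFour, h]

theorem image_mainChart : mainChart.image = mainFamily := by
  ext p
  constructor
  · rintro ⟨t, rfl⟩
    refine ⟨t 0, t 1, t 2, t 3, t 4, t 5, ?_⟩
    ext i
    rcases i with i | i <;> fin_cases i <;> simp [Chart.point, mainChart]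
  · rintro ⟨a, d, e, f, α, β, rfl⟩
    refine ⟨![a, d, e, f, α, β], ?_⟩
    ext i
    rcases i with i | i <;> fin_cases i <;> simp [Chart.point, mainChart]

end Charts

/-- The ten components up to permutation of the exponents. -/
def componentSet : Fin 10 → Set Param :=
  ![degenerateZero.image, degenerateTwo.image, degenerateFour.image, transverse.image,
    sigmaZero.image, sigmaOne.image, mainChart.image, sigmaThree.image, sigmaTwo.image,
    sigmaFour.image]

/-! ### Solving the equations -/

theorem forall_fin_six {P : Fin 6 → Prop} :
    (∀ j, P j) ↔ P 0 ∧ P 1 ∧ P 2 ∧ P 3 ∧ P 4 ∧ P 5 := by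
  simp [Fin.forall_fin_succ]

/-- The polar parts of orders three and two of `𝒬` at a simple root `-1/u` of the leading
coefficient `(1 + ux)(1 + vx)`. The numbers `r₁`, `r₂` and `k₁`, `k₂` are the residues of the
coefficients of `θ³` and `θ²` of the monic operator at the roots. -/
theorem polarParts_eq_zero {u v r₁ r₂ k₁ k₂ d s₃ : ℂ} (hu : u ≠ 0) (huv : u ≠ v)
    (h : ∀ j, numeratorCoeff (u + v) (r₁ * u + r₂ * v) (k₁ * u + k₂ * v) d (u * v)
      (r₁ + r₂) (k₁ + k₂) s₃ j = 0) :
    r₁ * (r₁ - 2) * (r₁ - 4) = 0 ∧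
      (r₁ - 2) * (4 * k₁ * (v - u) - 3 * v * r₁ * r₂ - 6 * r₁ * (v - u)) = 0 := by
  simp only [forall_fin_six, numeratorCoeff, Matrix.cons_val] at h
  obtain ⟨h₁, h₂, h₃, h₄, h₅, h₆⟩ := h
  have huv' : u - v ≠ 0 := sub_ne_zero.mpr huv
  have h3 : r₁ * (r₁ - 2) * (r₁ - 4) = 0 := by
    -- The combination is `u⁶` times the numerator of `8𝒬` evaluated at `x = -1/u`.
    have : u ^ 3 * (u - v) ^ 3 * (r₁ * (r₁ - 2) * (r₁ - 4)) = 0 := by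
      linear_combination -u ^ 5 * h₁ + u ^ 4 * h₂ - u ^ 3 * h₃ + u ^ 2 * h₄ - u * h₅ + h₆
    simpa [hu, huv'] using this
  refine ⟨h3, ?_⟩
  -- Here the numerator is replaced by its image under `x d/dx`, again at `x = -1/u`; the multiple
  -- of `h3` removes the contribution of the third-order pole.
  have : u ^ 3 * (u - v) ^ 2 *
      ((r₁ - 2) * (4 * k₁ * (v - u) - 3 * v * r₁ * r₂ - 6 * r₁ * (v - u))) = 0 := by
    linear_combination -u ^ 5 * h₁ + 2 * u ^ 4 * h₂ - 3 * u ^ 3 * h₃ + 4 * u ^ 2 * h₄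
      - 5 * u * h₅ + 6 * h₆ - (3 * u ^ 3 * (u - v) ^ 3 - 3 * u ^ 3 * (u - v) ^ 2 * v) * h3
  rcases mul_eq_zero.mp this with h0 | h0
  · exact absurd h0 (mul_ne_zero (pow_ne_zero 3 hu) (pow_ne_zero 2 huv'))
  · exact h0

/-- The polar parts of `𝒬` when the leading coefficient is `(1 + ux)²`. -/
theorem polarParts_eq_zero_of_double {u b k d s₁ s₂ s₃ : ℂ} (hu : u ≠ 0)
    (h : ∀ j, numeratorCoeff (u + u) b (u * k) d (u * u) s₁ s₂ s₃ j = 0) :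
    b = u * s₁ ∧ (s₁ - 4) * (4 * (s₂ - k) - s₁ * (s₁ - 2)) = 0 := by
  simp only [forall_fin_six, numeratorCoeff, Matrix.cons_val] at h
  obtain ⟨h₁, h₂, h₃, h₄, h₅, h₆⟩ := h
  have hb : b = u * s₁ := by
    have : u ^ 3 * (b - u * s₁) ^ 3 = 0 := by
      linear_combination -u ^ 5 * h₁ + u ^ 4 * h₂ - u ^ 3 * h₃ + u ^ 2 * h₄ - u * h₅ + h₆
    simpa [hu, sub_eq_zero] using this
  refine ⟨hb, ?_⟩
  subst hb
  have : u ^ 6 * ((s₁ - 4) * (4 * (s₂ - k) - s₁ * (s₁ - 2))) = 0 := by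
    linear_combination h₆ - u ^ 4 * h₂ + 4 * u ^ 5 * h₁
  simpa only [mul_eq_zero (a := u ^ 6), pow_ne_zero 6 hu, false_or] using this

/-- Partial fractions: `(bx + uvsx²) / ((1 + ux)(1 + vx)) = r₁ux / (1 + ux) + r₂vx / (1 + vx)`. The
linear system for `r₁, r₂` has determinant `±(u - v)`. -/
theorem exists_residues {u v : ℂ} (huv : u ≠ v) (b s : ℂ) :
    ∃ r₁ r₂ : ℂ, b = r₁ * u + r₂ * v ∧ s = r₁ + r₂ := by
  have huv' : u - v ≠ 0 := sub_ne_zero.mpr huv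
  refine ⟨(b - v * s) / (u - v), (u * s - b) / (u - v), ?_, ?_⟩ <;> field_simp <;> ring

theorem exists_factors (a f : ℂ) : ∃ u v : ℂ, a = u + v ∧ f = u * v := by
  obtain ⟨w, hw⟩ := IsAlgClosed.exists_pow_nat_eq (a ^ 2 - 4 * f) (n := 2) (by norm_num)
  exact ⟨(a + w) / 2, (a - w) / 2, by ring, by linear_combination hw / 4⟩

/-- Exponents whose pairwise sums are `2m` and for which the centered second moment vanishes are
a translate by `m` of the multiples of the fourth roots of unity. -/
theorem exists_perm_fourthRoots {p : Param} {m : ℂ} (h₀ : p (.inr 0) + p (.inr 2) = 2 * m)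
    (h₁ : p (.inr 1) + p (.inr 3) = 2 * m)
    (h : (p (.inr 0) - m) ^ 2 + (p (.inr 1) - m) ^ 2 = 0) :
    ∃ (τ : Equiv.Perm (Fin 4)) (α : ℂ),
      permuteExponents τ p (.inr 0) = m + α ∧ permuteExponents τ p (.inr 1) = m + Complex.I * α ∧
      permuteExponents τ p (.inr 2) = m - α ∧
      permuteExponents τ p (.inr 3) = m - Complex.I * α := by
  have hfac : (p (.inr 1) - m - Complex.I * (p (.inr 0) - m)) *
      (p (.inr 1) - m + Complex.I * (p (.inr 0) - m)) = 0 := by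
    linear_combination h - (p (.inr 0) - m) ^ 2 * Complex.I_sq
  rcases mul_eq_zero.mp hfac with hI | hI
  · refine ⟨1, p (.inr 0) - m, ?_⟩
    rw [permuteExponents_one]
    exact ⟨by ring, by linear_combination hI, by linear_combination h₀,
      by linear_combination h₁ - hI⟩
  -- Exchanging the exponents `β` and `δ`, which sum to `2m`, changes the sign of `β - m` and so
  -- turns the factor `-i` into `i`.
  · refine ⟨Equiv.swap 1 3, p (.inr 0) - m, ?_, ?_, ?_, ?_⟩
    · change p (.inr 0) = _
      ring
    · change p (.inr 3) = _
      linear_combination h₁ - hI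
    · change p (.inr 2) = _
      linear_combination h₀
    · change p (.inr 1) = _
      linear_combination hI

/-- The exponents enter the operator only through the symmetric product in `P₂`. -/
theorem mem_cySet_permuteExponents (τ : Equiv.Perm (Fin 4)) (p : Param) :
    permuteExponents τ p ∈ cySet ↔ p ∈ cySet := by
  have h₂ : P₂ (permuteExponents τ p) = P₂ p := by
    have := Equiv.prod_comp τ fun i => (Polynomial.X + Polynomial.C (p (.inr i)))
    simp only [P₂, permuteExponents, Sum.map_inl, Sum.map_inr, id, this]
  have h : thetaCoeff (permuteExponents τ p) = thetaCoeff p := by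
    funext k x
    simp only [thetaCoeff, h₂]
    rfl
  have h' : derivCoeff (permuteExponents τ p) = derivCoeff p := by
    funext j x
    simp only [derivCoeff, h]
  have h'' : monicCoeff (permuteExponents τ p) = monicCoeff p := by
    funext j x
    simp only [monicCoeff, h']
  change (∀ x, _ → _) ↔ (∀ x, _ → _)
  simp only [calQ, h', h'']

theorem exists_mem_componentSet_of_f_eq_zero {p : Param} (hp : ∀ j, cyEquation p j = 0)
    (hf : p (.inl 5) = 0) : ∃ i, p ∈ componentSet i := by
  simp only [forall_fin_six, cyEquation, numeratorCoeff, Matrix.cons_val, hf] at hp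
  obtain ⟨h₁, h₂, h₃, -⟩ := hp
  have hd : p (.inl 3) = p (.inl 2) - p (.inl 1) / 2 := by linear_combination -h₁ / 8
  rw [hd] at h₂ h₃
  have hfac : (p (.inl 1) - 2 * p (.inl 0)) * (2 * p (.inl 2) - 3 * p (.inl 1)) = 0 := by
    linear_combination h₂ / 2
  have htwo : p (.inl 1) - 2 * p (.inl 0) = 0 → ∃ i, p ∈ componentSet i := fun h =>
    ⟨1, mem_degenerateTwo.mpr ⟨by linear_combination h, by linear_combination -hd + h / 2, hf⟩⟩
  rcases mul_eq_zero.mp hfac with h | h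
  · exact htwo h
  have hc : p (.inl 2) = 3 / 2 * p (.inl 1) := by linear_combination h / 2
  rw [hc] at h₃ hd
  have hcub : p (.inl 1) * (p (.inl 1) - 2 * p (.inl 0)) * (p (.inl 1) - 4 * p (.inl 0)) = 0 := by
    linear_combination -h₃
  rcases mul_eq_zero.mp hcub with h | h
  · rcases mul_eq_zero.mp h with h | h
    · exact ⟨0, mem_degenerateZero.mpr ⟨h, by rw [hc, h, mul_zero], by rw [hd, h]; ring, hf⟩⟩
    · exact htwo h
  · have hb : p (.inl 1) = 4 * p (.inl 0) := by linear_combination h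
    exact ⟨2, mem_degenerateFour.mpr ⟨hb, by rw [hc, hb]; ring, by rw [hd, hb]; ring, hf⟩⟩

theorem exists_mem_componentSet_of_balanced {p : Param} (hp : ∀ j, cyEquation p j = 0)
    (hf : p (.inl 5) ≠ 0) (hbal : p (.inr 0) + p (.inr 2) = p (.inr 1) + p (.inr 3)) :
    ∃ i τ, permuteExponents τ p ∈ componentSet i := by
  have hd : p (.inl 3) = p (.inl 2) - p (.inl 1) / 2 := by
    have h₁ := hp 0
    simp only [cyEquation, numeratorCoeff, Matrix.cons_val] at h₁
    linear_combination -h₁ / 8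
  have hs₁ : esymmOne p = 2 * (p (.inr 0) + p (.inr 2)) := by
    rw [esymmOne]
    linear_combination -hbal
  have hs₂ : esymmTwo p = (p (.inr 0) + p (.inr 2)) ^ 2
      + p (.inr 0) * p (.inr 2) + p (.inr 1) * p (.inr 3) := by
    rw [esymmTwo]
    linear_combination -(p (.inr 0) + p (.inr 2)) * hbal
  have of_mem : ∀ i, p ∈ componentSet i → ∃ i τ, permuteExponents τ p ∈ componentSet i :=
    fun i h => ⟨i, 1, by rwa [permuteExponents_one]⟩
  have second : ∀ m, esymmOne p = 4 * m → p (.inr 0) + p (.inr 2) = 2 * m := fun m h => by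
    linear_combination (h - hs₁) / 2
  have fourth : ∀ m, esymmOne p = 4 * m → p (.inr 1) + p (.inr 3) = 2 * m := fun m h => by
    linear_combination (h - hs₁) / 2 - hbal
  -- When both pairs sum to `2m`, one has `s₂ = 6m² - (α - m)² - (β - m)²`.
  have moment : ∀ m, esymmOne p = 4 * m → esymmTwo p = 6 * m ^ 2 →
      (p (.inr 0) - m) ^ 2 + (p (.inr 1) - m) ^ 2 = 0 := fun m h h' => by
    have e₀ := second m h
    have e₁ := fourth m h
    rw [eq_sub_of_add_eq' e₀, eq_sub_of_add_eq' e₁] at hs₂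
    linear_combination hs₂ - h'
  have case_main : esymmOne p = 4 → p (.inl 1) = 2 * p (.inl 0) →
      ∃ i τ, permuteExponents τ p ∈ componentSet i := fun h hb => by
    have e₀ := second 1 (by rw [h]; ring)
    have e₁ := fourth 1 (by rw [h]; ring)
    refine of_mem 6 (mem_mainChart.mpr ⟨p (.inl 0), p (.inl 3), p (.inr 0), p (.inr 1), rfl, hb,
      ?_, rfl, rfl, rfl, ?_, ?_⟩)
    · linear_combination -hd + hb / 2
    · linear_combination e₀
    · linear_combination e₁
  obtain ⟨u, v, ha, huv⟩ := exists_factors (p (.inl 0)) (p (.inl 5))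
  have hu : u ≠ 0 := fun h => hf (by rw [huv, h, zero_mul])
  have hv : v ≠ 0 := fun h => hf (by rw [huv, h, mul_zero])
  by_cases hne : u = v
  · subst hne
    have hk : p (.inl 2) = u * (p (.inl 2) / u) := by field_simp
    generalize p (.inl 2) / u = k at hk
    have H := fun j => hp j
    simp only [cyEquation, ha, huv, hk] at H
    obtain ⟨hb, hfac⟩ := polarParts_eq_zero_of_double hu H
    -- The factor `s₁ - 4` leads to the main family; the other one determines `c` and gives the
    -- transverse family.
    rcases mul_eq_zero.mp hfac with h | h
    · have hs : esymmOne p = 4 := by linear_combination h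
      exact case_main hs (by rw [hb, hs, ha]; ring)
    · rw [hs₁] at hb h
      rw [hs₂] at h
      refine of_mem 3 (mem_transverse.mpr ⟨u, p (.inr 0) + p (.inr 2), p (.inr 0), p (.inr 1),
        by rw [ha]; ring, by rw [hb]; ring, ?_, ?_, by rw [huv]; ring, rfl, rfl, by ring, ?_⟩)
      · linear_combination hk - u / 4 * h - u * p (.inr 1) * hbal
      · linear_combination hd + hk - hb / 2 - u / 4 * h - u * p (.inr 1) * hbal
      · linear_combination -hbal
  have case_zero_two : ∀ u v k, p (.inl 0) = u + v → p (.inl 5) = u * v → p (.inl 1) = 2 * v →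
      p (.inl 2) = k * v → esymmTwo p = k → esymmOne p = 2 →
      ∃ i τ, permuteExponents τ p ∈ componentSet i := by
    intro u v k ha hf hb hc hk h
    have e₀ := second (1 / 2) (by rw [h]; ring)
    have e₁ := fourth (1 / 2) (by rw [h]; ring)
    rw [eq_sub_of_add_eq' e₀, eq_sub_of_add_eq' e₁, hk] at hs₂
    refine of_mem 5 (mem_sigmaOne.mpr ⟨u, v, p (.inr 0), p (.inr 1), ha, hb, ?_, ?_, hf, rfl, rfl,
      ?_, ?_⟩)
    · linear_combination hc + v * hs₂
    · linear_combination hd + hc - hb / 2 + v * hs₂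
    · linear_combination e₀
    · linear_combination e₁
  have case_zero_four : ∀ u v, p (.inl 0) = u + v → p (.inl 5) = u * v → p (.inl 1) = 4 * v →
      p (.inl 2) = 6 * v → esymmTwo p = 6 → esymmOne p = 4 →
      ∃ i τ, permuteExponents τ p ∈ componentSet i := by
    intro u v ha hf hb hc h₂ h₁
    obtain ⟨τ, α, hα⟩ := exists_perm_fourthRoots (second 1 (by rw [h₁]; ring))
      (fourth 1 (by rw [h₁]; ring)) (moment 1 (by rw [h₁]; ring) (by rw [h₂]; ring))
    exact ⟨8, τ, mem_sigmaTwo.mpr ⟨u, v, α, ha, hb, hc, by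
      change p (.inl 3) = _
      rw [hd, hc, hb]
      ring, hf, hα⟩⟩
  have case_two_four : ∀ u v k, p (.inl 0) = u + v → p (.inl 5) = u * v →
      p (.inl 1) = 2 * u + 4 * v → p (.inl 2) = (esymmTwo p - k) * u + k * v →
      k * (u - v) = 12 * u - 6 * v → esymmOne p = 6 →
      ∃ i τ, permuteExponents τ p ∈ componentSet i := by
    intro u v k ha hf hb hc hk h
    have e₀ := second (3 / 2) (by rw [h]; ring)
    have e₁ := fourth (3 / 2) (by rw [h]; ring)
    rw [eq_sub_of_add_eq' e₀, eq_sub_of_add_eq' e₁] at hs₂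
    refine of_mem 7 (mem_sigmaThree.mpr ⟨v, u, p (.inr 0) - 1, p (.inr 1) - 1, by rw [ha]; ring,
      by rw [hb]; ring, ?_, ?_, by rw [hf]; ring, by ring, by ring, ?_, ?_⟩)
    · linear_combination hc + u * hs₂ - hk
    · linear_combination hd + hc - hb / 2 + u * hs₂ - hk
    · linear_combination e₀
    · linear_combination e₁
  obtain ⟨r₁, r₂, hb, hr⟩ := exists_residues hne (p (.inl 1)) (esymmOne p)
  obtain ⟨k₁, k₂, hc, hk⟩ := exists_residues hne (p (.inl 2)) (esymmTwo p)
  have H := fun j => hp j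
  simp only [cyEquation, ha, huv, hb, hc, hr, hk] at H
  -- The system is symmetric in the two roots, so the polar conditions apply at `-1/v` as well.
  have H' : ∀ j, numeratorCoeff (v + u) (r₂ * v + r₁ * u) (k₂ * v + k₁ * u) (p (.inl 3)) (v * u)
      (r₂ + r₁) (k₂ + k₁) (esymmThree p) j = 0 := fun j => by
    rw [add_comm v, add_comm (r₂ * v), add_comm (k₂ * v), mul_comm v, add_comm r₂, add_comm k₂]
    exact H j
  obtain ⟨g₁, g₁'⟩ := polarParts_eq_zero hu hne H
  obtain ⟨g₂, g₂'⟩ := polarParts_eq_zero hv (Ne.symm hne) H'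
  have huv' : u - v ≠ 0 := sub_ne_zero.mpr hne
  have hvu' : v - u ≠ 0 := sub_ne_zero.mpr (Ne.symm hne)
  have hr₁ : r₁ = 0 ∨ r₁ = 2 ∨ r₁ = 4 := by simpa [sub_eq_zero, or_assoc] using g₁
  have hr₂ : r₂ = 0 ∨ r₂ = 2 ∨ r₂ = 4 := by simpa [sub_eq_zero, or_assoc] using g₂
  have k_zero : ∀ {k w : ℂ}, w ≠ 0 → k * w = 0 → k = 0 := fun hw h =>
    (mul_eq_zero.mp h).resolve_right hw
  -- Residue `0` forces `k = 0`. Residue `4` determines `k`, with value `6` if the other residue is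
  -- `0`. Residue `2` leaves `k` undetermined by the polar condition; opposite residue `0` or `4` it
  -- is then read off from `s₂`, and for the pair `(2, 2)` it is not needed.
  rcases hr₁ with rfl | rfl | rfl <;> rcases hr₂ with rfl | rfl | rfl
  · have hk₁ : k₁ = 0 := k_zero hvu' (by linear_combination -g₁' / 8)
    have hk₂ : k₂ = 0 := k_zero huv' (by linear_combination -g₂' / 8)
    rw [hk₁, hk₂] at hc hk
    obtain ⟨τ, α, hα⟩ := exists_perm_fourthRoots (second 0 (by rw [hr]; ring))
      (fourth 0 (by rw [hr]; ring)) (moment 0 (by rw [hr]; ring) (by rw [hk]; ring))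
    refine ⟨4, τ, mem_sigmaZero.mpr ⟨α, ?_, ?_, ?_, by simpa using hα⟩⟩
    · change p (.inl 1) = 0
      linear_combination hb
    · change p (.inl 2) = 0
      linear_combination hc
    · change p (.inl 3) = 0
      linear_combination hd + hc - hb / 2
  · have hk₁ : k₁ = 0 := k_zero hvu' (by linear_combination -g₁' / 8)
    rw [hk₁] at hc hk
    exact case_zero_two u v k₂ ha huv (by linear_combination hb) (by linear_combination hc)
      (by linear_combination hk) (by linear_combination hr)
  · have hk₁ : k₁ = 0 := k_zero hvu' (by linear_combination -g₁' / 8)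
    have hk₂ : k₂ - 6 = 0 := k_zero huv' (by linear_combination g₂' / 8)
    rw [hk₁] at hc hk
    exact case_zero_four u v ha huv (by linear_combination hb)
      (by linear_combination hc + v * hk₂) (by linear_combination hk + hk₂)
      (by linear_combination hr)
  · have hk₂ : k₂ = 0 := k_zero huv' (by linear_combination -g₂' / 8)
    rw [hk₂] at hc hk
    exact case_zero_two v u k₁ (by linear_combination ha) (by linear_combination huv)
      (by linear_combination hb) (by linear_combination hc) (by linear_combination hk)
      (by linear_combination hr)
  · exact case_main (by linear_combination hr) (by linear_combination hb - 2 * ha)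
  · exact case_two_four u v k₂ ha huv (by linear_combination hb)
      (by linear_combination hc - u * hk) (by linear_combination g₂' / 8) (by linear_combination hr)
  · have hk₁ : k₁ - 6 = 0 := k_zero hvu' (by linear_combination g₁' / 8)
    have hk₂ : k₂ = 0 := k_zero huv' (by linear_combination -g₂' / 8)
    rw [hk₂] at hc hk
    exact case_zero_four v u (by linear_combination ha) (by linear_combination huv)
      (by linear_combination hb) (by linear_combination hc + u * hk₁)
      (by linear_combination hk + hk₁) (by linear_combination hr)
  · exact case_two_four v u k₁ (by linear_combination ha)
      (by linear_combination huv) (by linear_combination hb)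
      (by linear_combination hc - v * hk) (by linear_combination g₁' / 8) (by linear_combination hr)
  · have e₁ : k₁ * (v - u) = 18 * v - 6 * u := by linear_combination g₁' / 8
    have e₂ : k₂ * (u - v) = 18 * u - 6 * v := by linear_combination g₂' / 8
    have hs : esymmTwo p - 24 = 0 := k_zero huv' (by
      linear_combination (u - v) * hk - e₁ + e₂)
    have hc' : p (.inl 2) - 6 * p (.inl 0) = 0 := k_zero huv' (by
      linear_combination (u - v) * hc - 6 * (u - v) * ha - u * e₁ + v * e₂)
    obtain ⟨τ, α, hα⟩ := exists_perm_fourthRoots (second 2 (by rw [hr]; ring))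
      (fourth 2 (by rw [hr]; ring))
      (moment 2 (by rw [hr]; ring) (by linear_combination hs))
    refine ⟨9, τ, mem_sigmaFour.mpr ⟨p (.inl 0), α, rfl, ?_, ?_, ?_, hα⟩⟩
    · change p (.inl 1) = _
      linear_combination hb - 4 * ha
    · change p (.inl 2) = _
      linear_combination hc'
    · change p (.inl 3) = _
      linear_combination hd + hc' - hb / 2 + 2 * ha

theorem exists_mem_componentSet {p : Param} (hp : p ∈ cySet) :
    ∃ i τ, permuteExponents τ p ∈ componentSet i := by
  have heq := (mem_cySet_iff p).mp hp
  by_cases hf : p (.inl 5) = 0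
  · obtain ⟨i, hi⟩ := exists_mem_componentSet_of_f_eq_zero heq hf
    exact ⟨i, 1, by rwa [permuteExponents_one]⟩
  have of_perm : ∀ τ : Equiv.Perm (Fin 4),
      p (.inr (τ 0)) + p (.inr (τ 2)) = p (.inr (τ 1)) + p (.inr (τ 3)) →
      ∃ i τ, permuteExponents τ p ∈ componentSet i := fun τ h => by
    have hτ := (mem_cySet_iff _).mp ((mem_cySet_permuteExponents τ p).mpr hp)
    obtain ⟨i, ρ, hρ⟩ := exists_mem_componentSet_of_balanced hτ hf h
    exact ⟨i, τ * ρ, by rwa [permuteExponents_permuteExponents] at hρ⟩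
  -- Expanding the product gives `s₁³ - 4s₁s₂ + 8s₃`. Each factor is one way to split the exponents
  -- into two pairs of equal sum, and a transposition moves it to the splitting `{α, γ}, {β, δ}`.
  have hfac : (p (.inr 0) + p (.inr 1) - p (.inr 2) - p (.inr 3)) *
      (p (.inr 0) + p (.inr 2) - p (.inr 1) - p (.inr 3)) *
      (p (.inr 0) + p (.inr 3) - p (.inr 1) - p (.inr 2)) = 0 := by
    have h₆ := heq 5
    simp only [cyEquation, numeratorCoeff, Matrix.cons_val] at h₆
    have : p (.inl 5) ^ 3 * (8 * esymmThree p - 4 * esymmOne p * esymmTwo p + esymmOne p ^ 3) =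
        0 := by
      linear_combination -h₆
    have := (mul_eq_zero.mp this).resolve_left (pow_ne_zero 3 hf)
    rw [esymmOne, esymmTwo, esymmThree] at this
    linear_combination this
  rcases mul_eq_zero.mp hfac with h | h
  · rcases mul_eq_zero.mp h with h | h
    · refine of_perm (Equiv.swap 1 2) ?_
      change p (.inr 0) + p (.inr 1) = p (.inr 2) + p (.inr 3)
      linear_combination h
    · refine of_perm 1 ?_
      change p (.inr 0) + p (.inr 2) = p (.inr 1) + p (.inr 3)
      linear_combination h
  · refine of_perm (Equiv.swap 2 3) ?_
    change p (.inr 0) + p (.inr 3) = p (.inr 1) + p (.inr 2)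
    linear_combination h

theorem componentSet_subset_cySet (i : Fin 10) : componentSet i ⊆ cySet := by
  intro p hp
  rw [mem_cySet_iff, forall_fin_six]
  -- Since `∏ₖ (y + m + iᵏα) = (y + m)⁴ - α⁴`, only the fourth elementary symmetric function depends
  -- on `α`.
  have esymm_roots : ∀ m α, p (.inr 0) = m + α ∧ p (.inr 1) = m + Complex.I * α ∧
      p (.inr 2) = m - α ∧ p (.inr 3) = m - Complex.I * α →
      esymmOne p = 4 * m ∧ esymmTwo p = 6 * m ^ 2 ∧ esymmThree p = 4 * m ^ 3 := by
    rintro m α ⟨h₀, h₁, h₂, h₃⟩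
    rw [esymmOne, esymmTwo, esymmThree, h₀, h₁, h₂, h₃]
    exact ⟨by ring, by linear_combination -α ^ 2 * Complex.I_sq,
      by linear_combination -2 * m * α ^ 2 * Complex.I_sq⟩
  fin_cases i
  · obtain ⟨hb, hc, hd, hf⟩ := mem_degenerateZero.mp hp
    simp only [cyEquation, numeratorCoeff, Matrix.cons_val, hb, hc, hd, hf]
    refine ⟨?_, ?_, ?_, ?_, ?_, ?_⟩ <;> ring
  · obtain ⟨hb, hc, hf⟩ := mem_degenerateTwo.mp hp
    simp only [cyEquation, numeratorCoeff, Matrix.cons_val, hb, hc, hf]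
    refine ⟨?_, ?_, ?_, ?_, ?_, ?_⟩ <;> ring
  · obtain ⟨hb, hc, hd, hf⟩ := mem_degenerateFour.mp hp
    simp only [cyEquation, numeratorCoeff, Matrix.cons_val, hb, hc, hd, hf]
    refine ⟨?_, ?_, ?_, ?_, ?_, ?_⟩ <;> ring
  · obtain ⟨t, σ, α, β, ha, hb, hc, hd, hf, h₀, h₁, h₂, h₃⟩ := mem_transverse.mp hp
    simp only [cyEquation, numeratorCoeff, Matrix.cons_val, esymmOne, esymmTwo, esymmThree,
      ha, hb, hc, hd, hf, h₀, h₁, h₂, h₃]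
    refine ⟨?_, ?_, ?_, ?_, ?_, ?_⟩ <;> ring
  · obtain ⟨α, hb, hc, hd, h₀, h₁, h₂, h₃⟩ := mem_sigmaZero.mp hp
    obtain ⟨e₁, e₂, e₃⟩ := esymm_roots 0 α ⟨by rw [h₀]; ring, by rw [h₁]; ring, by rw [h₂]; ring,
      by rw [h₃]; ring⟩
    simp only [cyEquation, numeratorCoeff, Matrix.cons_val, hb, hc, hd, e₁, e₂, e₃]
    refine ⟨?_, ?_, ?_, ?_, ?_, ?_⟩ <;> ring
  · obtain ⟨u, v, α, β, ha, hb, hc, hd, hf, h₀, h₁, h₂, h₃⟩ := mem_sigmaOne.mp hp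
    simp only [cyEquation, numeratorCoeff, Matrix.cons_val, esymmOne, esymmTwo, esymmThree,
      ha, hb, hc, hd, hf, h₀, h₁, h₂, h₃]
    refine ⟨?_, ?_, ?_, ?_, ?_, ?_⟩ <;> ring
  · obtain ⟨a, d, α, β, ha, hb, hc, hd, h₀, h₁, h₂, h₃⟩ := mem_mainChart.mp hp
    simp only [cyEquation, numeratorCoeff, Matrix.cons_val, esymmOne, esymmTwo, esymmThree,
      ha, hb, hc, hd, h₀, h₁, h₂, h₃]
    refine ⟨?_, ?_, ?_, ?_, ?_, ?_⟩ <;> ring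
  · obtain ⟨u, v, α, β, ha, hb, hc, hd, hf, h₀, h₁, h₂, h₃⟩ := mem_sigmaThree.mp hp
    simp only [cyEquation, numeratorCoeff, Matrix.cons_val, esymmOne, esymmTwo, esymmThree,
      ha, hb, hc, hd, hf, h₀, h₁, h₂, h₃]
    refine ⟨?_, ?_, ?_, ?_, ?_, ?_⟩ <;> ring
  · obtain ⟨u, v, α, ha, hb, hc, hd, hf, h⟩ := mem_sigmaTwo.mp hp
    obtain ⟨e₁, e₂, e₃⟩ := esymm_roots 1 α h
    simp only [cyEquation, numeratorCoeff, Matrix.cons_val, ha, hb, hc, hd, hf, e₁, e₂, e₃]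
    refine ⟨?_, ?_, ?_, ?_, ?_, ?_⟩ <;> ring
  · obtain ⟨a, α, ha, hb, hc, hd, h⟩ := mem_sigmaFour.mp hp
    obtain ⟨e₁, e₂, e₃⟩ := esymm_roots 2 α h
    simp only [cyEquation, numeratorCoeff, Matrix.cons_val, ha, hb, hc, hd, e₁, e₂, e₃]
    refine ⟨?_, ?_, ?_, ?_, ?_, ?_⟩ <;> ring

theorem exists_chart (i : Fin 10) : ∃ (n : ℕ) (c : Chart n), componentSet i = c.image := by
  fin_cases i <;> exact ⟨_, _, rfl⟩

theorem isIrreducibleAlgebraicSet_permuteExponents_image (i : Fin 10) (τ : Equiv.Perm (Fin 4)) :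
    IsIrreducibleAlgebraicSet (permuteExponents τ '' componentSet i) := by
  obtain ⟨n, c, hc⟩ := exists_chart i
  rw [hc, ← c.image_permute τ]
  exact (c.permute τ).isIrreducibleAlgebraicSet_image

theorem cySet_eq_iUnion :
    cySet = ⋃ k : Fin 10 × Equiv.Perm (Fin 4), permuteExponents k.2 '' componentSet k.1 := by
  ext p
  rw [Set.mem_iUnion]
  constructor
  · intro hp
    obtain ⟨i, τ, h⟩ := exists_mem_componentSet hp
    exact ⟨(i, τ⁻¹), mem_image_permuteExponents.mpr (by rwa [inv_inv])⟩
  · rintro ⟨⟨i, τ⟩, q, hq, rfl⟩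
    exact (mem_cySet_permuteExponents τ q).mpr (componentSet_subset_cySet i hq)

/-! ### Separating the components -/

/-- Conditions that are invariant under permutations of the exponents and hold on the ten
components. -/
def separatingCondition (p : Param) : Fin 10 → Prop :=
  ![p (.inl 5) = 0 ∧ p (.inl 1) = 0,
    p (.inl 5) = 0 ∧ p (.inl 1) = 2 * p (.inl 0),
    p (.inl 5) = 0 ∧ p (.inl 1) = 4 * p (.inl 0),
    p (.inl 0) ^ 2 = 4 * p (.inl 5),
    sigma p = 0,
    sigma p = 1,
    sigma p = 2 ∧ p (.inl 1) = 2 * p (.inl 0),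
    sigma p = 3,
    sigma p = 2 ∧ 2 * p (.inl 2) = 3 * p (.inl 1),
    sigma p = 4]

theorem separatingCondition_permuteExponents (τ : Equiv.Perm (Fin 4)) (p : Param) :
    separatingCondition (permuteExponents τ p) = separatingCondition p := by
  simp only [separatingCondition, sigma_permuteExponents]
  rfl

theorem separatingCondition_of_mem {i : Fin 10} {p : Param} (hp : p ∈ componentSet i) :
    separatingCondition p i := by
  have hsigma : sigma p = (p (.inr 0) + p (.inr 1) + p (.inr 2) + p (.inr 3)) / 2 := by
    rw [sigma, Fin.sum_univ_four]
  fin_cases i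
  · obtain ⟨hb, -, -, hf⟩ := mem_degenerateZero.mp hp
    exact ⟨hf, hb⟩
  · obtain ⟨hb, -, hf⟩ := mem_degenerateTwo.mp hp
    exact ⟨hf, hb⟩
  · obtain ⟨hb, -, -, hf⟩ := mem_degenerateFour.mp hp
    exact ⟨hf, hb⟩
  · obtain ⟨t, σ, α, β, ha, -, -, -, hf, -⟩ := mem_transverse.mp hp
    change p (.inl 0) ^ 2 = 4 * p (.inl 5)
    rw [ha, hf]
    ring
  · obtain ⟨α, -, -, -, h₀, h₁, h₂, h₃⟩ := mem_sigmaZero.mp hp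
    change sigma p = 0
    rw [hsigma, h₀, h₁, h₂, h₃]
    ring
  · obtain ⟨u, v, α, β, -, -, -, -, -, h₀, h₁, h₂, h₃⟩ := mem_sigmaOne.mp hp
    change sigma p = 1
    rw [hsigma, h₀, h₁, h₂, h₃]
    ring
  · obtain ⟨a, d, α, β, ha, hb, -, -, h₀, h₁, h₂, h₃⟩ := mem_mainChart.mp hp
    refine ⟨?_, by rw [hb, ha]⟩
    rw [hsigma, h₀, h₁, h₂, h₃]
    ring
  · obtain ⟨u, v, α, β, -, -, -, -, -, h₀, h₁, h₂, h₃⟩ := mem_sigmaThree.mp hp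
    change sigma p = 3
    rw [hsigma, h₀, h₁, h₂, h₃]
    ring
  · obtain ⟨u, v, α, -, hb, hc, -, -, h₀, h₁, h₂, h₃⟩ := mem_sigmaTwo.mp hp
    refine ⟨?_, by rw [hb, hc]; ring⟩
    rw [hsigma, h₀, h₁, h₂, h₃]
    ring
  · obtain ⟨a, α, -, -, -, -, h₀, h₁, h₂, h₃⟩ := mem_sigmaFour.mp hp
    change sigma p = 4
    rw [hsigma, h₀, h₁, h₂, h₃]
    ring

/-- A point on each component that lies on no other component. -/
def separatingPoint : Fin 10 → Param :=
  ![Sum.elim ![1, 0, 0, 0, 0, 0] ![10, 0, 0, 0],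
    Sum.elim ![1, 2, 1, 0, 0, 0] ![10, 0, 0, 0],
    Sum.elim ![1, 4, 6, 4, 0, 0] ![10, 0, 0, 0],
    Sum.elim ![2, 10, 5, 0, 0, 1] ![0, 0, 5, 5],
    Sum.elim ![0, 0, 0, 0, 0, 1] ![0, 0, 0, 0],
    Sum.elim ![3, 4, 2, 0, 0, 2] ![0, 0, 1, 1],
    Sum.elim ![0, 0, 1, 1, 0, 1] ![0, 0, 2, 2],
    Sum.elim ![3, 8, 8, 4, 0, 2] ![1, 1, 2, 2],
    Sum.elim ![3, 8, 12, 8, 0, 2] ![1, 1, 1, 1],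
    Sum.elim ![0, 0, 0, 0, 0, 1] ![2, 2, 2, 2]]

theorem separatingPoint_mem (i : Fin 10) : separatingPoint i ∈ componentSet i := by
  fin_cases i
  · exact mem_degenerateZero.mpr (by simp [separatingPoint])
  · exact mem_degenerateTwo.mpr (by simp [separatingPoint])
  · exact mem_degenerateFour.mpr (by simp [separatingPoint])
  · exact mem_transverse.mpr ⟨1, 5, 0, 0, by simp [separatingPoint]; norm_num⟩
  · exact mem_sigmaZero.mpr ⟨0, by simp [separatingPoint]⟩
  · exact mem_sigmaOne.mpr ⟨1, 2, 0, 0, by simp [separatingPoint]; norm_num⟩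
  · exact mem_mainChart.mpr ⟨0, 1, 0, 0, by simp [separatingPoint]⟩
  · exact mem_sigmaThree.mpr ⟨1, 2, 0, 0, by simp [separatingPoint]; norm_num⟩
  · exact mem_sigmaTwo.mpr ⟨1, 2, 0, by simp [separatingPoint]; norm_num⟩
  · exact mem_sigmaFour.mpr ⟨0, 0, by simp [separatingPoint]⟩

/-- The points are chosen for this: `σ = 5` on the degenerate and transverse ones avoids every
constant value of `σ`, all but the transverse one have `a² ≠ 4f`, and the two points with `σ = 2`
differ in whether `b = 2a` or `2c = 3b`. -/
theorem eq_of_separatingCondition {i j : Fin 10}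
    (h : separatingCondition (separatingPoint i) j) : i = j := by
  fin_cases i <;> fin_cases j <;>
    first
    | rfl
    | (simp [separatingCondition, separatingPoint, sigma, Fin.sum_univ_four] at h; done)
    | (simp [separatingCondition, separatingPoint, sigma, Fin.sum_univ_four] at h; norm_num at h)

theorem eq_of_permuteExponents_image_subset {i j : Fin 10} {τ ρ : Equiv.Perm (Fin 4)}
    (h : permuteExponents τ '' componentSet i ⊆ permuteExponents ρ '' componentSet j) :
    i = j := by
  have := mem_image_permuteExponents.mp (h ⟨_, separatingPoint_mem i, rfl⟩)
  have := separatingCondition_of_mem this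
  rw [separatingCondition_permuteExponents, separatingCondition_permuteExponents] at this
  exact eq_of_separatingCondition this

theorem isComponent_cySet_iff {W : Set Param} :
    IsComponent cySet W ↔ ∃ (i : Fin 10) (τ : Equiv.Perm (Fin 4)),
      W = permuteExponents τ '' componentSet i := by
  rw [isComponent_iff_of_eq_iUnion cySet_eq_iUnion
    (fun k => isIrreducibleAlgebraicSet_permuteExponents_image k.1 k.2) ?_, Prod.exists]
  rintro ⟨i, τ⟩ ⟨j, ρ⟩ h
  obtain rfl := eq_of_permuteExponents_image_subset h
  exact permuteExponents_image_eq_of_subset h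

end CYDegreeTwo

end

/-! ### The classification theorem. -/

open CYDegreeTwo in
theorem mainTheorem1 :
    IsAlgebraicSet cySet ∧
    cySet = ⋃₀ {Z | IsComponent cySet Z} ∧
    ∃ Y : Fin 10 → Set Param,
      -- the components of `X` are the sets `Y i` up to reordering the exponents,
      -- and no two of the ten are equivalent
      (∀ (i : Fin 10) (τ : Equiv.Perm (Fin 4)),
        IsComponent cySet (permuteExponents τ '' Y i)) ∧
      (∀ Z, IsComponent cySet Z →
        ∃! i, ∃ τ : Equiv.Perm (Fin 4), Z = permuteExponents τ '' Y i) ∧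
      -- three components with `f = 0`, seven with `f ≠ 0`
      (∀ i : Fin 10, i < 3 → ∀ p ∈ Y i, p (.inl 5) = 0) ∧
      (∀ i : Fin 10, 3 ≤ i → ∃ p ∈ Y i, p (.inl 5) ≠ 0) ∧
      -- the transverse component
      (∃ p ∈ Y 3, ∃ q ∈ Y 3, sigma p ≠ sigma q) ∧
      dimension (Y 3) = 5 ∧
      -- the six components on which `σ` is fixed
      (∀ j : Fin 6,
        (∀ p ∈ Y (Fin.natAdd 4 j), sigma p = (![0, 1, 2, 3, 2, 4] : Fin 6 → ℂ) j) ∧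
        dimension (Y (Fin.natAdd 4 j)) = ((![4, 5, 6, 5, 4, 4] : Fin 6 → ℕ) j : Cardinal)) ∧
      -- the main component, the one with `σ = 2` and dimension `6`
      Y 6 = mainFamily := by
  refine ⟨?_, ?_, componentSet, ?_, ?_, ?_, ?_, ?_, ?_, ?_, image_mainChart⟩
  · rw [cySet_eq_iUnion]
    exact isAlgebraicSet_iUnion _
      fun k => (isIrreducibleAlgebraicSet_permuteExponents_image k.1 k.2).1
  · refine Set.Subset.antisymm (fun p hp => ?_) (Set.sUnion_subset fun Z hZ => hZ.1.2)
    rw [cySet_eq_iUnion, Set.mem_iUnion] at hp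
    obtain ⟨⟨i, τ⟩, h⟩ := hp
    exact ⟨_, isComponent_cySet_iff.mpr ⟨i, τ, rfl⟩, h⟩
  · exact fun i τ => isComponent_cySet_iff.mpr ⟨i, τ, rfl⟩
  · intro Z hZ
    obtain ⟨i, τ, rfl⟩ := isComponent_cySet_iff.mp hZ
    exact ⟨i, ⟨τ, rfl⟩, fun j ⟨ρ, h⟩ => (eq_of_permuteExponents_image_subset h.subset).symm⟩
  · intro i hi p hp
    have := separatingCondition_of_mem hp
    fin_cases i
    · exact this.1
    · exact this.1
    · exact this.1
    all_goals exact absurd hi (by decide)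
  · intro i hi
    refine ⟨_, separatingPoint_mem i, ?_⟩
    fin_cases i
    iterate 3 exact absurd hi (by decide)
    all_goals simp [separatingPoint]
  -- The separating point has `σ = 5`, the origin has `σ = 0`.
  · refine ⟨_, separatingPoint_mem 3, 0, mem_transverse.mpr ⟨0, 0, 0, 0, by simp⟩, ?_⟩
    simp [separatingPoint, sigma, Fin.sum_univ_four]
  · exact transverse.dimension_image
  · intro j
    constructor
    · intro p hp
      have := separatingCondition_of_mem hp
      fin_cases j
      · exact this
      · exact this
      · exact this.1
      · exact this
      · exact this.1
      · exact this
    · fin_cases j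
      · exact sigmaZero.dimension_image
      · exact sigmaOne.dimension_image
      · exact mainChart.dimension_image
      · exact sigmaThree.dimension_image
      · exact sigmaTwo.dimension_image
      · exact sigmaFour.dimension_image
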